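/- Theorem 4.4. Let $\Omega\subset\mathbb R^N$ be open and bounded, and let its boundary be the disjoint union of three parts $\Gamma_1,\Gamma_2,\Gamma_3$, where near every point of $\Gamma_2$ the boundary is of class $C^1$ with $\Omega$ lying locally on one side of it; let $n$ denote the outward unit normal on $\Gamma_2$. For $c\in\mathbb R$, say that $w$ satisfies the mixed conditions with datum $c$ if $w\in C^0(\overline\Omega)$, $\nabla w$ extends continuously from $\Omega$ to $\Omega\cup\Gamma_2$, and $$w=0\ \text{on }\Gamma_1,\qquad \frac{\partial w}{\partial n}=0\ \text{on }\Gamma_2,\qquad w=c\ \text{on }\Gamma_3 .$$ Assume that $\Omega,\Gamma_1,\Gamma_2,\Gamma_3$ are such that the mixed problem for the Laplacian, $\Delta z=0$ in $\Omega$ with the mixed conditions with datum $1$, has one and only one classical solution $z$ (that is, $z\in C^2(\Omega)$ satisfying these conditions). Let $a\in C^0(\mathbb R^2)$ with $a(u,p)\ge\alpha>0$ for all $(u,p)\in\mathbb R^2$, and let $u^*,p^*\in\mathbb R$ be constants with $p^*\neq0$. Consider the problem $$\nabla\cdot(a(u,p)\nabla u)=0,\qquad \nabla\cdot(a(u,p)\nabla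 p)=0\qquad\text{in }\Omega,$$ where $u$ and $p$ satisfy the mixed conditions with data $u^*$ and $p^*$ respectively. Let $\mathcal C$ be the set of its classical solutions, i.e. of the pairs $(u,p)$ such that $u$, $p$ and the fluxes $a(u,p)\nabla u$, $a(u,p)\nabla p$ are of class $C^1$ in $\Omega$, the equations hold at every point of $\Omega$, and the boundary conditions hold in the above sense. Let $\mathcal C_F\subset\mathcal C$ be the set of functional solutions, i.e. of those $(u,p)\in\mathcal C$ such that $p$ takes its values in the closed interval $I$ with end points $0$ and $p^*$ and $u=U(p)$ on $\overline\Omega$ for some $U\in C^1(I)$. Then the problem has one and only one classical solution $(u,p)$ (as functions on $\overline\Omega$). It is a functional solution, and $u=\dfrac{u^*}{p^*}\,p$ on $\overline\Omega$. Consequently $\mathcal C_F=\mathcal C$. -/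

import Mathlib

noncomputable section

namespace MixedProblem

/-- Euclidean space `ℝ^N`. -/
abbrev Space (N : ℕ) : Type := EuclideanSpace ℝ (Fin N)

/-- Divergence of a vector field, `∑ i, ∂ F_i / ∂ x_i`. -/
def divergence {N : ℕ} (F : Space N → Space N) (x : Space N) : ℝ :=
  ∑ i : Fin N, (fderiv ℝ F x (EuclideanSpace.single i 1)) i

/-- `ν` is the outward unit normal to `Ω` at the boundary point `x`, near which the boundary is of
class `C¹` with `Ω` on one side: in a neighbourhood `V` of `x` the set `Ω` is `{ρ < 0}` for a
`C¹` function `ρ` with `ρ x = 0`, `∇ρ x ≠ 0`, and `ν = ∇ρ x / ‖∇ρ x‖`. -/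
def IsOuterUnitNormal {N : ℕ} (Ω : Set (Space N)) (x ν : Space N) : Prop :=
  ∃ (V : Set (Space N)) (ρ : Space N → ℝ), IsOpen V ∧ x ∈ V ∧ ContDiffOn ℝ 1 ρ V ∧
    Ω ∩ V = {y ∈ V | ρ y < 0} ∧ ρ x = 0 ∧ gradient ρ x ≠ 0 ∧
    ν = ‖gradient ρ x‖⁻¹ • gradient ρ x

/-- `∂w/∂n = 0` on `Γ`, for `w` of class `C¹` up to `Γ`: the gradient of `w` in `Ω` extends
continuously to `Ω ∪ Γ`, and the extension is orthogonal to the normal on `Γ`. -/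
def HasZeroNormalDeriv {N : ℕ} (Ω Γ : Set (Space N)) (w : Space N → ℝ) : Prop :=
  ∃ G : Space N → Space N, ContinuousOn G (Ω ∪ Γ) ∧ (∀ x ∈ Ω, G x = gradient w x) ∧
    ∀ x ∈ Γ, ∀ ν, IsOuterUnitNormal Ω x ν → inner ℝ (G x) ν = 0

/-- `w` is continuous on the closure of `Ω` and satisfies
`w = 0` on `Γ₁`, `∂w/∂n = 0` on `Γ₂`, `w = c` on `Γ₃`. -/
structure MixedBoundaryConditions {N : ℕ} (Ω Γ₁ Γ₂ Γ₃ : Set (Space N)) (c : ℝ)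
    (w : Space N → ℝ) : Prop where
  continuousOn : ContinuousOn w (closure Ω)
  eq_zero : ∀ x ∈ Γ₁, w x = 0
  normalDeriv : HasZeroNormalDeriv Ω Γ₂ w
  eq_const : ∀ x ∈ Γ₃, w x = c

/-- Classical solutions of the mixed problem for the Laplacian: `Δz = 0` in `Ω`,
`z = 0` on `Γ₁`, `∂z/∂n = 0` on `Γ₂`, `z = 1` on `Γ₃`. -/
structure IsMixedHarmonic {N : ℕ} (Ω Γ₁ Γ₂ Γ₃ : Set (Space N)) (z : Space N → ℝ) : Prop where
  contDiffOn : ContDiffOn ℝ 2 z Ω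
  laplacian_eq_zero : ∀ x ∈ Ω, Laplacian.laplacian z x = 0
  boundary : MixedBoundaryConditions Ω Γ₁ Γ₂ Γ₃ 1 z

/-- The mixed problem for the Laplacian has one and only one classical solution
(functions being compared on the closure of `Ω`, where the problem lives). -/
def MixedLaplaceUniquelySolvable {N : ℕ} (Ω Γ₁ Γ₂ Γ₃ : Set (Space N)) : Prop :=
  (∃ z, IsMixedHarmonic Ω Γ₁ Γ₂ Γ₃ z) ∧
    ∀ z z', IsMixedHarmonic Ω Γ₁ Γ₂ Γ₃ z → IsMixedHarmonic Ω Γ₁ Γ₂ Γ₃ z' →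
      Set.EqOn z z' (closure Ω)

/-- `∇·(A∇w) = 0` in `Ω` in the classical sense: `w` and the flux `A∇w` are of class `C¹` in `Ω`
and the divergence of the flux vanishes at every point of `Ω`. -/
structure SolvesDivEq {N : ℕ} (Ω : Set (Space N)) (A w : Space N → ℝ) : Prop where
  contDiffOn : ContDiffOn ℝ 1 w Ω
  flux_contDiffOn : ContDiffOn ℝ 1 (fun x => A x • gradient w x) Ω
  divergence_eq_zero : ∀ x ∈ Ω, divergence (fun y => A y • gradient w y) x = 0

/-- The set `𝒞` of classical solutions `(u, p)` of `∇·(a(u,p)∇u) = 0`, `∇·(a(u,p)∇p) = 0` in `Ω`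
with `u = p = 0` on `Γ₁`, `∂u/∂n = ∂p/∂n = 0` on `Γ₂`, `u = u*` and `p = p*` on `Γ₃`. -/
def classicalSolutions {N : ℕ} (Ω Γ₁ Γ₂ Γ₃ : Set (Space N)) (a : ℝ → ℝ → ℝ) (uStar pStar : ℝ) :
    Set ((Space N → ℝ) × (Space N → ℝ)) :=
  {s | SolvesDivEq Ω (fun x => a (s.1 x) (s.2 x)) s.1 ∧
    SolvesDivEq Ω (fun x => a (s.1 x) (s.2 x)) s.2 ∧
    MixedBoundaryConditions Ω Γ₁ Γ₂ Γ₃ uStar s.1 ∧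
    MixedBoundaryConditions Ω Γ₁ Γ₂ Γ₃ pStar s.2}

/-- The set `𝒞_F` of functional solutions: classical solutions `(u, p)` for which there is a `C¹`
function `U` on the closed interval with end points `0` and `p*` such that `p` takes its values in
that interval and `u = U(p)`. -/
def functionalSolutions {N : ℕ} (Ω Γ₁ Γ₂ Γ₃ : Set (Space N)) (a : ℝ → ℝ → ℝ) (uStar pStar : ℝ) :
    Set ((Space N → ℝ) × (Space N → ℝ)) :=
  {s | s ∈ classicalSolutions Ω Γ₁ Γ₂ Γ₃ a uStar pStar ∧
    ∃ U : ℝ → ℝ, ContDiffOn ℝ 1 U (Set.uIcc 0 pStar) ∧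
      ∀ x ∈ closure Ω, s.2 x ∈ Set.uIcc 0 pStar ∧ s.1 x = U (s.2 x)}

end MixedProblem

end

open MeasureTheory Set Filter Topology InnerProductSpace

namespace MixedProblem

variable {N : ℕ}

/-! ### Divergence, gradient and Laplacian -/

section Divergence

/-! For a given classical solution `(v, q)`, freeze the coefficient `A = a(v, q)`. Both components
then solve the same linear equation `∇·(A∇w) = 0`, hence so does `v - (u*/p*) q`, whose Dirichlet
data are all `0`. A maximum principle (`SolvesDivEq.mem_uIcc`) forces it to vanish, and also
confines `q` to the interval between `0` and `p*`. So every classical solution is functional, with a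
linear `U`.

The system thereby collapses to the single equation `∇·(b(q)∇q) = 0` with `b(s) = a((u*/p*) s, s)`.
If `Φ` is the primitive of `b` vanishing at `0`, then `∇Φ(q)` is the flux, so `Φ(q)/Φ(p*)` is
harmonic with datum `1` and must equal `z`. This gives uniqueness; inverting `Φ`, which is a
diffeomorphism because `b ≥ α > 0`, gives existence: `p = Φ⁻¹(Φ(p*) z)`, `u = (u*/p*) p`.

The maximum principle is an energy argument. Nothing is known about the regularity of `Γ₁` and `Γ₃`
or about the integrability of `∇w`, so the test function is `φ(w)`, where `φ` vanishes below a level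
`m > max 0 c`. The set `{w ≥ m}` is compact and meets the boundary only in `Γ₂`, where the flux is
tangential; a divergence theorem for such fields (`setIntegral_divergence_eq_zero`) gives `∇(φ(w)) =
0`. A component of `Ω` might a priori see no Dirichlet data, so this does not yet give `φ(w) = 0`.
But `z + φ(w)` solves the mixed Laplace problem again, and the assumed uniqueness finishes the
argument. -/

theorem divergence_congr {F H : Space N → Space N} {x : Space N} (h : F =ᶠ[𝓝 x] H) :
    divergence F x = divergence H x := by
  simp only [divergence, h.fderiv_eq]

theorem divergence_smul {f : Space N → ℝ} {H : Space N → Space N} {x : Space N}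
    (hf : DifferentiableAt ℝ f x) (hH : DifferentiableAt ℝ H x) :
    divergence (fun y => f y • H y) x = f x * divergence H x + fderiv ℝ f x (H x) := by
  have hsum : H x = ∑ i : Fin N, H x i • EuclideanSpace.single i (1 : ℝ) := by
    conv_lhs => rw [← (EuclideanSpace.basisFun (Fin N) ℝ).sum_repr (H x)]
    simp
  conv_rhs => rw [hsum, map_sum]
  simp only [divergence, fderiv_fun_smul hf hH, Finset.mul_sum, ← Finset.sum_add_distrib]
  refine Finset.sum_congr rfl fun i _ => ?_
  simp [mul_comm]

theorem divergence_const_smul {H : Space N → Space N} {x : Space N} (c : ℝ)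
    (hH : DifferentiableAt ℝ H x) :
    divergence (fun y => c • H y) x = c * divergence H x := by
  simpa using divergence_smul (differentiableAt_const c) hH

theorem divergence_add {F H : Space N → Space N} {x : Space N}
    (hF : DifferentiableAt ℝ F x) (hH : DifferentiableAt ℝ H x) :
    divergence (fun y => F y + H y) x = divergence F x + divergence H x := by
  simp [divergence, fderiv_fun_add hF hH, Finset.sum_add_distrib]

theorem gradient_eq_toDual_symm (f : Space N → ℝ) :
    gradient f = fun x => (toDual ℝ (Space N)).symm (fderiv ℝ f x) := rfl

theorem contDiffOn_gradient {f : Space N → ℝ} {s : Set (Space N)} (hs : IsOpen s)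
    {m n : WithTop ℕ∞} (hf : ContDiffOn ℝ n f s) (hmn : m + 1 ≤ n) :
    ContDiffOn ℝ m (gradient f) s :=
  (toDual ℝ (Space N)).symm.contDiff.comp_contDiffOn (hf.fderiv_of_isOpen hs hmn)

/-- Solutions of the divergence equation are only `C¹` with a `C¹` flux. This recovers the `C²`
regularity of their Kirchhoff transform, whose gradient is a multiple of that flux. -/
theorem contDiffOn_of_gradient {f : Space N → ℝ} {s : Set (Space N)} (hs : IsOpen s)
    (hf : DifferentiableOn ℝ f s) (hg : ContDiffOn ℝ 1 (gradient f) s) :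
    ContDiffOn ℝ 2 f s := by
  rw [show (2 : WithTop ℕ∞) = 1 + 1 from (one_add_one_eq_two).symm,
    contDiffOn_succ_iff_fderiv_of_isOpen hs]
  refine ⟨hf, by simp, ?_⟩
  refine ((toDual ℝ (Space N)).contDiff.comp_contDiffOn hg).congr fun x _ => ?_
  exact (toDual_gradient).symm

theorem divergence_gradient {f : Space N → ℝ} {x : Space N} (hf : ContDiffAt ℝ 2 f x) :
    divergence (gradient f) x = Laplacian.laplacian f x := by
  have hd : DifferentiableAt ℝ (fderiv ℝ f) x :=
    (hf.fderiv_right (m := 1) (by norm_num [one_add_one_eq_two])).differentiableAt (by simp)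
  rw [laplacian_eq_iteratedFDeriv_orthonormalBasis f (EuclideanSpace.basisFun (Fin N) ℝ)]
  simp only [divergence, gradient_eq_toDual_symm]
  refine Finset.sum_congr rfl fun i _ => ?_
  have h1 : fderiv ℝ (fun x => (toDual ℝ (Space N)).symm (fderiv ℝ f x)) x
      (EuclideanSpace.single i 1) =
      (toDual ℝ (Space N)).symm (fderiv ℝ (fderiv ℝ f) x (EuclideanSpace.single i 1)) := by
    have := ((toDual ℝ (Space N)).symm.toContinuousLinearEquiv.toContinuousLinearMap.hasFDerivAt
      (x := fderiv ℝ f x)).comp x hd.hasFDerivAt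
    exact congrArg (fun T => T (EuclideanSpace.single i 1)) this.fderiv
  rw [h1, iteratedFDeriv_two_apply]
  have h2 : ∀ v : Space N, v i = inner ℝ v (EuclideanSpace.single i (1 : ℝ)) := by
    intro v; simp [EuclideanSpace.inner_single_right]
  rw [h2, toDual_symm_apply]
  simp

end Divergence

/-! ### Fields with compact support in the whole space -/

section IntegrationByParts

theorem integrable_fderiv_apply {f : Space N → ℝ} (hf : ContDiff ℝ 1 f)
    (hc : HasCompactSupport f) (v : Space N) : Integrable (fun x => fderiv ℝ f x v) :=
  ((hf.continuous_fderiv (by simp)).clm_apply continuous_const).integrable_of_hasCompactSupport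
    (hc.fderiv_apply (𝕜 := ℝ) v)

theorem integral_fderiv_apply_eq_zero {f : Space N → ℝ} (hf : ContDiff ℝ 1 f)
    (hc : HasCompactSupport f) (v : Space N) : ∫ x, fderiv ℝ f x v = 0 := by
  have hi := integrable_fderiv_apply hf hc v
  -- Integration by parts against the constant function `1`.
  have := integral_mul_fderiv_eq_neg_fderiv_mul_of_integrable (μ := (volume : Measure (Space N)))
    (f := fun _ => (1 : ℝ)) (g := f) (v := v) (by simp) (by simpa using hi)
    (by simpa using hf.continuous.integrable_of_hasCompactSupport hc)
    (fun x _ => differentiableAt_const _)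
    (fun x _ => (hf.differentiable (by simp)).differentiableAt)
  simpa using this

theorem divergence_eq_sum_fderiv_apply {H : Space N → Space N} {x : Space N}
    (hH : DifferentiableAt ℝ H x) :
    divergence H x = ∑ i, fderiv ℝ (fun x => H x i) x (EuclideanSpace.single i 1) := by
  refine Finset.sum_congr rfl fun i _ => ?_
  have := ((EuclideanSpace.proj i : Space N →L[ℝ] ℝ).hasFDerivAt (x := H x)).comp x hH.hasFDerivAt
  exact (congrArg (fun T => T (EuclideanSpace.single i 1)) this.fderiv).symm

theorem contDiff_apply {H : Space N → Space N} (hH : ContDiff ℝ 1 H) (i : Fin N) :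
    ContDiff ℝ 1 (fun x => H x i) :=
  (EuclideanSpace.proj (𝕜 := ℝ) i).contDiff.comp hH

theorem hasCompactSupport_apply {H : Space N → Space N} (hc : HasCompactSupport H) (i : Fin N) :
    HasCompactSupport (fun x => H x i) :=
  hc.comp_left (g := fun v : Space N => v i) (by simp)

theorem integrable_divergence {H : Space N → Space N} (hH : ContDiff ℝ 1 H)
    (hc : HasCompactSupport H) : Integrable (divergence H) := by
  have : divergence H = fun x =>
      ∑ i, fderiv ℝ (fun x => H x i) x (EuclideanSpace.single i 1) :=
    funext fun x => divergence_eq_sum_fderiv_apply (hH.differentiable (by simp) x)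
  rw [this]
  exact integrable_finsetSum _ fun i _ =>
    integrable_fderiv_apply (contDiff_apply hH i) (hasCompactSupport_apply hc i) _

theorem integral_divergence_eq_zero {H : Space N → Space N} (hH : ContDiff ℝ 1 H)
    (hc : HasCompactSupport H) : ∫ x, divergence H x = 0 := by
  simp only [divergence_eq_sum_fderiv_apply (hH.differentiable (by simp) _)]
  rw [integral_finsetSum _ fun i _ =>
    integrable_fderiv_apply (contDiff_apply hH i) (hasCompactSupport_apply hc i) _]
  exact Finset.sum_eq_zero fun i _ =>
    integral_fderiv_apply_eq_zero (contDiff_apply hH i) (hasCompactSupport_apply hc i) _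

end IntegrationByParts

/-! ### Cutoff near the boundary -/

section Cutoff

/-- A smooth nonincreasing function equal to `1` on `(-∞, -2]` and to `0` on `[-1, ∞)`. -/
noncomputable def cutoff (s : ℝ) : ℝ := Real.smoothTransition (-1 - s)

theorem contDiff_cutoff : ContDiff ℝ 1 cutoff :=
  Real.smoothTransition.contDiff.comp (contDiff_const.sub contDiff_id)

theorem cutoff_nonneg (s : ℝ) : 0 ≤ cutoff s := Real.smoothTransition.nonneg _

theorem cutoff_le_one (s : ℝ) : cutoff s ≤ 1 := Real.smoothTransition.le_one _

theorem cutoff_eq_one {s : ℝ} (hs : s ≤ -2) : cutoff s = 1 :=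
  Real.smoothTransition.one_of_one_le (by linarith)

theorem cutoff_eq_zero {s : ℝ} (hs : -1 ≤ s) : cutoff s = 0 :=
  Real.smoothTransition.zero_of_nonpos (by linarith)

theorem antitone_cutoff : Antitone cutoff := fun _ _ h =>
  Real.smoothTransition.monotone (by linarith)

theorem deriv_cutoff_nonpos (s : ℝ) : deriv cutoff s ≤ 0 := antitone_cutoff.deriv_nonpos

theorem deriv_cutoff_eq_zero {s : ℝ} (hs : s < -2) : deriv cutoff s = 0 := by
  have : cutoff =ᶠ[𝓝 s] fun _ => 1 := by
    filter_upwards [Iio_mem_nhds hs] with t ht using cutoff_eq_one ht.le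
  simp [this.deriv_eq]

variable {Ω V : Set (Space N)} {ρ χ : Space N → ℝ}

/-- Outside `Ω ∩ V` a point of the support of `χ` has `ρ ≥ 0`, so `k * ρ > -1` in a whole
neighbourhood. This is why `cutoff` dies at `-1` and not at `0`. -/
theorem cutoff_mul_eventuallyEq_zero (hV : IsOpen V) (hρ : ContDiffOn ℝ 1 ρ V)
    (hΩV : Ω ∩ V = {y ∈ V | ρ y < 0}) (hχV : tsupport χ ⊆ V) {k : ℝ} (hk : 0 < k)
    {x : Space N} (hx : x ∉ Ω ∩ V) :
    (fun x => cutoff (k * ρ x) * χ x) =ᶠ[𝓝 x] fun _ => 0 := by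
  by_cases hxχ : x ∈ tsupport χ
  · have hxV := hχV hxχ
    have hx0 : 0 ≤ ρ x := by
      by_contra h
      exact hx (hΩV ▸ ⟨hxV, not_le.1 h⟩)
    have hcont : ContinuousAt (fun y => k * ρ y) x :=
      continuousAt_const.mul (hρ.contDiffAt (hV.mem_nhds hxV)).continuousAt
    have hlt : (-1 : ℝ) < k * ρ x := by nlinarith
    filter_upwards [hcont.eventually (lt_mem_nhds hlt)] with y hy
    simp [cutoff_eq_zero hy.le]
  · filter_upwards [notMem_tsupport_iff_eventuallyEq.1 hxχ] with y hy
    simp [hy]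

/-- `F` is controlled only inside `Ω`; its values elsewhere are harmless because the factor vanishes
near every point outside `Ω ∩ V`. -/
theorem contDiff_cutoff_smul {X : Type*} [NormedAddCommGroup X] [NormedSpace ℝ X]
    (hΩ : IsOpen Ω) (hV : IsOpen V) (hρ : ContDiffOn ℝ 1 ρ V)
    (hΩV : Ω ∩ V = {y ∈ V | ρ y < 0}) (hχ : ContDiff ℝ 1 χ) (hχV : tsupport χ ⊆ V)
    {F : Space N → X} (hF : ContDiffOn ℝ 1 F Ω) {k : ℝ} (hk : 0 < k) :
    ContDiff ℝ 1 (fun x => (cutoff (k * ρ x) * χ x) • F x) := by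
  rw [contDiff_iff_contDiffAt]
  intro x
  by_cases hx : x ∈ Ω ∩ V
  · exact ((contDiff_cutoff.contDiffAt.comp x (contDiffAt_const.mul
      (hρ.contDiffAt (hV.mem_nhds hx.2)))).mul hχ.contDiffAt).smul
      (hF.contDiffAt (hΩ.mem_nhds hx.1))
  · refine (contDiffAt_const (c := (0 : X))).congr_of_eventuallyEq ?_
    filter_upwards [cutoff_mul_eventuallyEq_zero hV hρ hΩV hχV hk hx] with y hy
    simp [hy]

theorem hasFDerivAt_cutoff_mul {k : ℝ} {x : Space N} (hρ : DifferentiableAt ℝ ρ x)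
    (hχ : DifferentiableAt ℝ χ x) :
    HasFDerivAt (fun x => cutoff (k * ρ x) * χ x)
      (cutoff (k * ρ x) • fderiv ℝ χ x +
        (χ x * (k * deriv cutoff (k * ρ x))) • fderiv ℝ ρ x) x := by
  have h1 : HasDerivAt cutoff (deriv cutoff (k * ρ x)) (k * ρ x) :=
    (contDiff_cutoff.differentiable (by simp)).differentiableAt.hasDerivAt
  have h2 := h1.comp_hasFDerivAt x (hρ.hasFDerivAt.const_mul k)
  have h3 := h2.mul hχ.hasFDerivAt
  refine h3.congr_fderiv ?_
  simp only [smul_smul, Function.comp_apply]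
  ring_nf

theorem continuousOn_cutoff (hρ : ContDiffOn ℝ 1 ρ V) (k : ℝ) :
    ContinuousOn (fun x => cutoff (k * ρ x)) (Ω ∩ V) :=
  contDiff_cutoff.continuous.comp_continuousOn
    (continuousOn_const.mul (hρ.continuousOn.mono inter_subset_right))

theorem integrableOn_cutoff_mul (hΩ : IsOpen Ω) (hV : IsOpen V) (hρ : ContDiffOn ℝ 1 ρ V)
    (k : ℝ) {f : Space N → ℝ} (hf : IntegrableOn f (Ω ∩ V)) :
    IntegrableOn (fun x => cutoff (k * ρ x) * f x) (Ω ∩ V) := by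
  refine Integrable.mono hf (((continuousOn_cutoff hρ k).aestronglyMeasurable
    (hΩ.inter hV).measurableSet).mul hf.aestronglyMeasurable) (ae_of_all _ fun x => ?_)
  rw [norm_mul, Real.norm_of_nonneg (cutoff_nonneg _)]
  exact mul_le_of_le_one_left (norm_nonneg _) (cutoff_le_one _)

end Cutoff

/-! ### Divergence theorem in a chart, without surface measure -/

section Boundary

variable {Ω V : Set (Space N)} {ρ χ : Space N → ℝ}

/-- A bound uniform in `k` for the mass of the boundary layer. The derivative of `cutoff (k * ρ) *
χ` along the transversal direction `e` has integral zero, which balances the layer term, weighted by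
`∂ρ/∂e ≥ c`, against `∫ cutoff (k * ρ) * ∂χ/∂e`. -/
theorem integral_abs_deriv_cutoff_le (hΩ : IsOpen Ω) (hV : IsOpen V)
    (hρ : ContDiffOn ℝ 1 ρ V) (hΩV : Ω ∩ V = {y ∈ V | ρ y < 0})
    {e : Space N} {c : ℝ} (hc : 0 < c) (hρe : ∀ y ∈ V, c ≤ fderiv ℝ ρ y e)
    (hχ : ContDiff ℝ 1 χ) (hχc : HasCompactSupport χ) (hχV : tsupport χ ⊆ V)
    (hχ0 : ∀ x, 0 ≤ χ x) {k : ℝ} (hk : 0 < k) :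
    IntegrableOn (fun x => χ x * (k * |deriv cutoff (k * ρ x)|)) (Ω ∩ V) ∧
    ∫ x in Ω ∩ V, χ x * (k * |deriv cutoff (k * ρ x)|) ≤ c⁻¹ * ∫ x, |fderiv ℝ χ x e| := by
  have hD : MeasurableSet (Ω ∩ V) := (hΩ.inter hV).measurableSet
  have hψ : ContDiff ℝ 1 (fun x => cutoff (k * ρ x) * χ x) := by
    simpa using contDiff_cutoff_smul hΩ hV hρ hΩV hχ hχV
      (contDiffOn_const (c := (1 : ℝ))) hk
  have hψc : HasCompactSupport (fun x => cutoff (k * ρ x) * χ x) := hχc.mul_left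
  have hψ' : ∀ x ∈ Ω ∩ V, fderiv ℝ (fun x => cutoff (k * ρ x) * χ x) x e =
      cutoff (k * ρ x) * fderiv ℝ χ x e +
        χ x * (k * deriv cutoff (k * ρ x)) * fderiv ℝ ρ x e := by
    intro x hx
    rw [(hasFDerivAt_cutoff_mul ((hρ.contDiffAt (hV.mem_nhds hx.2)).differentiableAt (by simp))
      (hχ.differentiable (by simp) x)).fderiv]
    simp
  have hψ0 : ∀ x, x ∉ Ω ∩ V → fderiv ℝ (fun x => cutoff (k * ρ x) * χ x) x e = 0 := by
    intro x hx
    simp [(cutoff_mul_eventuallyEq_zero hV hρ hΩV hχV hk hx).fderiv_eq]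
  have hχi := integrable_fderiv_apply hχ hχc e
  have hψi := integrable_fderiv_apply hψ hψc e
  have hηi := integrableOn_cutoff_mul (Ω := Ω) hΩ hV hρ k hχi.integrableOn
  have hψint : ∫ x in Ω ∩ V, fderiv ℝ (fun x => cutoff (k * ρ x) * χ x) x e = 0 := by
    rw [setIntegral_eq_integral_of_forall_compl_eq_zero hψ0]
    exact integral_fderiv_apply_eq_zero hψ hψc e
  have hmaj : IntegrableOn (fun x => c⁻¹ * (cutoff (k * ρ x) * fderiv ℝ χ x e -
      fderiv ℝ (fun x => cutoff (k * ρ x) * χ x) x e)) (Ω ∩ V) :=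
    (hηi.sub hψi.integrableOn).const_mul _
  have hle : ∀ x ∈ Ω ∩ V, χ x * (k * |deriv cutoff (k * ρ x)|) ≤
      c⁻¹ * (cutoff (k * ρ x) * fderiv ℝ χ x e -
        fderiv ℝ (fun x => cutoff (k * ρ x) * χ x) x e) := by
    intro x hx
    rw [hψ' x hx, abs_of_nonpos (deriv_cutoff_nonpos _), inv_mul_eq_div, le_div_iff₀ hc]
    have h1 : 0 ≤ χ x * (k * -deriv cutoff (k * ρ x)) :=
      mul_nonneg (hχ0 x) (mul_nonneg hk.le (neg_nonneg.2 (deriv_cutoff_nonpos _)))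
    nlinarith [mul_le_mul_of_nonneg_left (hρe x hx.2) h1]
  have hint : IntegrableOn (fun x => χ x * (k * |deriv cutoff (k * ρ x)|)) (Ω ∩ V) := by
    refine Integrable.mono' hmaj (ContinuousOn.aestronglyMeasurable ?_ hD) ?_
    · refine hχ.continuous.continuousOn.mul (continuousOn_const.mul ?_)
      exact ((contDiff_cutoff.continuous_deriv le_rfl).comp_continuousOn
        (continuousOn_const.mul (hρ.continuousOn.mono inter_subset_right))).abs
    · filter_upwards [ae_restrict_mem hD] with x hx
      rw [Real.norm_of_nonneg (mul_nonneg (hχ0 x) (mul_nonneg hk.le (abs_nonneg _)))]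
      exact hle x hx
  refine ⟨hint, (setIntegral_mono_on hint hmaj hD hle).trans ?_⟩
  rw [integral_const_mul, integral_sub hηi hψi.integrableOn, hψint, sub_zero]
  refine mul_le_mul_of_nonneg_left ?_ (inv_nonneg.2 hc.le)
  calc ∫ x in Ω ∩ V, cutoff (k * ρ x) * fderiv ℝ χ x e
      ≤ ∫ x in Ω ∩ V, |fderiv ℝ χ x e| := by
        refine setIntegral_mono_on hηi hχi.abs.integrableOn hD fun x _ => ?_
        refine (le_abs_self _).trans ?_
        rw [abs_mul, abs_of_nonneg (cutoff_nonneg _)]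
        exact mul_le_of_le_one_left (abs_nonneg _) (cutoff_le_one _)
    _ ≤ ∫ x, |fderiv ℝ χ x e| :=
        setIntegral_le_integral hχi.abs (ae_of_all _ fun x => abs_nonneg _)

/-- The divergence theorem in a boundary chart, for a field `χ • F` with vanishing normal
component on the boundary. -/
theorem setIntegral_divergence_smul_eq_zero_of_boundary_chart (hΩ : IsOpen Ω) (hV : IsOpen V)
    (hρ : ContDiffOn ℝ 1 ρ V) (hΩV : Ω ∩ V = {y ∈ V | ρ y < 0})
    {e : Space N} {c : ℝ} (hc : 0 < c) (hρe : ∀ y ∈ V, c ≤ fderiv ℝ ρ y e)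
    (hχ : ContDiff ℝ 1 χ) (hχc : HasCompactSupport χ) (hχV : tsupport χ ⊆ V)
    (hχ0 : ∀ x, 0 ≤ χ x) {F : Space N → Space N} (hF : ContDiffOn ℝ 1 F Ω)
    (hint : IntegrableOn (fun x => χ x * divergence F x + fderiv ℝ χ x (F x)) Ω)
    (hlim : ∀ ε > 0, ∃ δ > 0, ∀ x ∈ Ω ∩ V, -δ < ρ x → χ x ≠ 0 → |fderiv ℝ ρ x (F x)| ≤ ε) :
    ∫ x in Ω, (χ x * divergence F x + fderiv ℝ χ x (F x)) = 0 := by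
  have hD : MeasurableSet (Ω ∩ V) := (hΩ.inter hV).measurableSet
  set d : Space N → ℝ := fun x => χ x * divergence F x + fderiv ℝ χ x (F x) with hd
  have hΩD : ∫ x in Ω, d x = ∫ x in Ω ∩ V, d x := by
    refine (setIntegral_eq_of_subset_of_forall_sdiff_eq_zero hΩ.measurableSet
      inter_subset_left fun x hx => ?_)
    have hxχ : x ∉ tsupport χ := fun h => hx.2 ⟨hx.1, hχV h⟩
    have := notMem_tsupport_iff_eventuallyEq.1 hxχ
    simp [hd, this.eq_of_nhds, this.fderiv_eq]
  have hdi : IntegrableOn d (Ω ∩ V) := hint.mono_set inter_subset_left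
  set k : ℕ → ℝ := fun n => n + 1 with hk
  have hkpos : ∀ n, 0 < k n := fun n => by positivity
  -- Pointwise in `Ω ∩ V` the cutoff is eventually `1`, because `ρ < 0` there.
  have htend : Tendsto (fun n => ∫ x in Ω ∩ V, cutoff (k n * ρ x) * d x) atTop
      (𝓝 (∫ x in Ω ∩ V, d x)) := by
    refine tendsto_integral_of_dominated_convergence (fun x => |d x|)
      (fun n => (integrableOn_cutoff_mul hΩ hV hρ _ hdi).aestronglyMeasurable) hdi.abs
      (fun n => ae_of_all _ fun x => ?_) ?_
    · rw [norm_mul, Real.norm_of_nonneg (cutoff_nonneg _)]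
      exact mul_le_of_le_one_left (norm_nonneg _) (cutoff_le_one _)
    · filter_upwards [ae_restrict_mem hD] with x hx
      have hx0 : ρ x < 0 := by
        rw [hΩV] at hx
        exact hx.2
      have hkt : Tendsto k atTop atTop :=
        tendsto_natCast_atTop_atTop.atTop_add tendsto_const_nhds
      refine tendsto_const_nhds.congr' ?_
      filter_upwards [(hkt.atTop_mul_const_of_neg hx0).eventually (eventually_le_atBot (-2))]
        with n hn
      rw [cutoff_eq_one hn, one_mul]
  -- The cut-off field is `C¹` with compact support, so its divergence integrates to zero. What
  -- remains besides the cut-off integrand is the flux through the layer.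
  have hflux : ∀ n, IntegrableOn (fun x => χ x * (k n * deriv cutoff (k n * ρ x)) *
      fderiv ℝ ρ x (F x)) (Ω ∩ V) ∧ ∫ x in Ω ∩ V, cutoff (k n * ρ x) * d x =
      -∫ x in Ω ∩ V, χ x * (k n * deriv cutoff (k n * ρ x)) * fderiv ℝ ρ x (F x) := by
    intro n
    have hH := contDiff_cutoff_smul hΩ hV hρ hΩV hχ hχV hF (hkpos n)
    have hHc : HasCompactSupport (fun x => (cutoff (k n * ρ x) * χ x) • F x) :=
      (HasCompactSupport.mul_left (f := fun x => cutoff (k n * ρ x)) hχc).smul_right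
    have hdiv : ∀ x ∈ Ω ∩ V, divergence (fun x => (cutoff (k n * ρ x) * χ x) • F x) x =
        cutoff (k n * ρ x) * d x +
          χ x * (k n * deriv cutoff (k n * ρ x)) * fderiv ℝ ρ x (F x) := by
      intro x hx
      have h1 := hasFDerivAt_cutoff_mul (k := k n)
        ((hρ.contDiffAt (hV.mem_nhds hx.2)).differentiableAt (by simp))
        (hχ.differentiable (by simp) x)
      rw [divergence_smul h1.differentiableAt
        ((hF.contDiffAt (hΩ.mem_nhds hx.1)).differentiableAt (by simp)), h1.fderiv]
      simp [hd]
      ring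
    have hdiv0 : ∀ x, x ∉ Ω ∩ V →
        divergence (fun x => (cutoff (k n * ρ x) * χ x) • F x) x = 0 := by
      intro x hx
      have : (fun x => (cutoff (k n * ρ x) * χ x) • F x) =ᶠ[𝓝 x] fun _ => 0 := by
        filter_upwards [cutoff_mul_eventuallyEq_zero hV hρ hΩV hχV (hkpos n) hx] with y hy
        simp [hy]
      rw [divergence_congr this]
      simp [divergence]
    have hdivi := integrable_divergence hH hHc
    have hηi := integrableOn_cutoff_mul hΩ hV hρ (k n) hdi
    have hI : IntegrableOn (fun x => χ x * (k n * deriv cutoff (k n * ρ x)) *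
        fderiv ℝ ρ x (F x)) (Ω ∩ V) := by
      refine (hdivi.integrableOn.sub hηi).congr_fun (fun x hx => ?_) hD
      simp [hdiv x hx]
    refine ⟨hI, ?_⟩
    rw [eq_neg_iff_add_eq_zero, ← integral_add hηi hI, ← setIntegral_congr_fun hD hdiv,
      setIntegral_eq_integral_of_forall_compl_eq_zero hdiv0]
    exact integral_divergence_eq_zero hH hHc
  have hzero : Tendsto (fun n => ∫ x in Ω ∩ V, cutoff (k n * ρ x) * d x) atTop (𝓝 0) := by
    set C : ℝ := c⁻¹ * ∫ x, |fderiv ℝ χ x e| with hC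
    have hC0 : 0 ≤ C := mul_nonneg (inv_nonneg.2 hc.le) (integral_nonneg fun x => abs_nonneg _)
    rw [Metric.tendsto_atTop]
    intro ε hε
    -- `C` bounds the mass of the layer; `C + 1` avoids division by zero.
    obtain ⟨δ, hδ, hsmall⟩ := hlim (ε / (C + 1)) (by positivity)
    obtain ⟨n₀, hn₀⟩ := exists_nat_gt (2 / δ)
    refine ⟨n₀, fun n hn => ?_⟩
    obtain ⟨hTi, hTle⟩ := integral_abs_deriv_cutoff_le hΩ hV hρ hΩV hc hρe hχ hχc hχV hχ0
      (hkpos n)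
    -- Where `ρ ≤ -δ` this gives `k n * ρ < -2`, so the derivative of the cutoff vanishes: the layer
    -- lies where the normal component is small.
    have hkn : 2 < k n * δ := by
      rw [div_lt_iff₀ hδ] at hn₀
      have : (n₀ : ℝ) ≤ n := by exact_mod_cast hn
      simp only [hk]
      nlinarith
    rw [(hflux n).2, dist_zero_right, norm_neg]
    calc ‖∫ x in Ω ∩ V, χ x * (k n * deriv cutoff (k n * ρ x)) * fderiv ℝ ρ x (F x)‖
        ≤ ∫ x in Ω ∩ V, ‖χ x * (k n * deriv cutoff (k n * ρ x)) * fderiv ℝ ρ x (F x)‖ :=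
          norm_integral_le_integral_norm _
      _ ≤ ∫ x in Ω ∩ V, χ x * (k n * |deriv cutoff (k n * ρ x)|) * (ε / (C + 1)) := by
          refine setIntegral_mono_on (hflux n).1.norm (hTi.mul_const _) hD fun x hx => ?_
          rw [norm_mul, norm_mul, norm_mul, Real.norm_of_nonneg (hχ0 x),
            Real.norm_of_nonneg (hkpos n).le, Real.norm_eq_abs, Real.norm_eq_abs]
          by_cases hχx : χ x = 0
          · simp [hχx]
          by_cases hρx : -δ < ρ x
          · exact mul_le_mul_of_nonneg_left (hsmall x hx hρx hχx)
              (mul_nonneg (hχ0 x) (mul_nonneg (hkpos n).le (abs_nonneg _)))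
          · have : k n * ρ x < -2 := by nlinarith [hkpos n]
            simp [deriv_cutoff_eq_zero this]
      _ ≤ C * (ε / (C + 1)) := by
          rw [integral_mul_const]
          exact mul_le_mul_of_nonneg_right hTle (by positivity)
      _ < ε := by
          rw [mul_div_assoc', div_lt_iff₀ (by positivity)]
          nlinarith
  rw [hΩD]
  exact tendsto_nhds_unique htend hzero

/-- The divergence theorem for a field `χ • F` supported inside `Ω`. -/
theorem setIntegral_divergence_smul_eq_zero_of_tsupport_subset (hΩ : IsOpen Ω)
    (hχ : ContDiff ℝ 1 χ) (hχc : HasCompactSupport χ) (hχΩ : tsupport χ ⊆ Ω)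
    {F : Space N → Space N} (hF : ContDiffOn ℝ 1 F Ω) :
    ∫ x in Ω, (χ x * divergence F x + fderiv ℝ χ x (F x)) = 0 := by
  have hH : ContDiff ℝ 1 (fun x => χ x • F x) := by
    refine contDiff_iff_contDiffAt.2 fun x => ?_
    by_cases hx : x ∈ tsupport χ
    · exact hχ.contDiffAt.smul (hF.contDiffAt (hΩ.mem_nhds (hχΩ hx)))
    · refine (contDiffAt_const (c := (0 : Space N))).congr_of_eventuallyEq ?_
      filter_upwards [notMem_tsupport_iff_eventuallyEq.1 hx] with y hy
      simp [hy]
  have hdiv : EqOn (fun x => χ x * divergence F x + fderiv ℝ χ x (F x))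
      (divergence fun x => χ x • F x) Ω := fun x hx =>
    (divergence_smul (hχ.differentiable (by simp) x)
      ((hF.contDiffAt (hΩ.mem_nhds hx)).differentiableAt (by simp))).symm
  rw [setIntegral_congr_fun hΩ.measurableSet hdiv,
    setIntegral_eq_integral_of_forall_compl_eq_zero]
  · exact integral_divergence_eq_zero hH hχc.smul_right
  · intro x hx
    have : (fun x => χ x • F x) =ᶠ[𝓝 x] fun _ => 0 := by
      filter_upwards [notMem_tsupport_iff_eventuallyEq.1 fun h => hx (hχΩ h)] with y hy
      simp [hy]
    rw [divergence_congr this]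
    simp [divergence]

end Boundary

/-! ### Divergence theorem on `Ω`: localization and patching -/

section Global

variable {Ω Γ K : Set (Space N)} {F : Space N → Space N}

theorem exists_forall_norm_le_of_eq_zero_off_compact (hK : IsCompact K)
    (hFK : ContinuousOn F K) (hzero : ∀ x ∈ Ω, x ∉ K → F x = 0) :
    ∃ M, ∀ x ∈ Ω, ‖F x‖ ≤ M := by
  obtain ⟨M, hM⟩ := hK.exists_bound_of_continuousOn hFK
  refine ⟨max M 0, fun x hx => ?_⟩
  by_cases hxK : x ∈ K
  · exact (hM x hxK).trans (le_max_left _ _)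
  · simp [hzero x hx hxK]

theorem continuousOn_divergence (hΩ : IsOpen Ω) (hF : ContDiffOn ℝ 1 F Ω) :
    ContinuousOn (divergence F) Ω := by
  have h := hF.continuousOn_fderiv_of_isOpen hΩ (by simp)
  refine continuousOn_finsetSum _ fun i _ => ?_
  exact (EuclideanSpace.proj (𝕜 := ℝ) i).continuous.comp_continuousOn
    (h.clm_apply continuousOn_const)

theorem integrableOn_divergence_smul (hΩ : IsOpen Ω) (hΩb : Bornology.IsBounded Ω)
    (hF : ContDiffOn ℝ 1 F Ω) {M M' : ℝ} (hFM : ∀ x ∈ Ω, ‖F x‖ ≤ M)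
    (hdM : ∀ x ∈ Ω, |divergence F x| ≤ M') {χ : Space N → ℝ} (hχ : ContDiff ℝ 1 χ)
    (hχc : HasCompactSupport χ) :
    IntegrableOn (fun x => χ x * divergence F x + fderiv ℝ χ x (F x)) Ω := by
  have hχ' := hχ.continuous_fderiv (by simp)
  obtain ⟨C, hC⟩ := hχc.exists_bound_of_continuous hχ.continuous
  obtain ⟨C', hC'⟩ := (hχc.fderiv (𝕜 := ℝ)).exists_bound_of_continuous hχ'
  refine IntegrableOn.of_bound hΩb.measure_lt_top
    (ContinuousOn.aestronglyMeasurable ?_ hΩ.measurableSet) (C * M' + C' * M) ?_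
  · exact (hχ.continuous.continuousOn.mul (continuousOn_divergence hΩ hF)).add
      (hχ'.continuousOn.clm_apply hF.continuousOn)
  · filter_upwards [ae_restrict_mem hΩ.measurableSet] with x hx
    refine (norm_add_le _ _).trans (add_le_add ?_ ?_)
    · rw [norm_mul]
      exact mul_le_mul (hC x) (hdM x hx) (norm_nonneg _) ((norm_nonneg _).trans (hC x))
    · exact (ContinuousLinearMap.le_opNorm _ _).trans
        (mul_le_mul (hC' x) (hFM x hx) (norm_nonneg _) ((norm_nonneg _).trans (hC' x)))

/-- A chart built around one boundary point serves at every other boundary point `y` in it. Indeed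
`ρ y = 0`, since `ρ y > 0` would keep `Ω` away from `y` and `ρ y < 0` would put `y` in `Ω`. If the
gradient vanishes at `y` the claim is trivial. -/
theorem fderiv_apply_eq_zero_of_normal {V : Set (Space N)} {ρ : Space N → ℝ} (hV : IsOpen V)
    (hρ : ContDiffOn ℝ 1 ρ V) (hΩV : Ω ∩ V = {y ∈ V | ρ y < 0}) {y v : Space N}
    (hy : y ∈ frontier Ω) (hyΩ : y ∉ Ω) (hyV : y ∈ V)
    (hnormal : ∀ ν, IsOuterUnitNormal Ω y ν → inner ℝ v ν = 0) : fderiv ℝ ρ y v = 0 := by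
  by_cases hg : gradient ρ y = 0
  · rw [← inner_gradient_left, hg, inner_zero_left]
  have hρy : ρ y = 0 := by
    refine le_antisymm ?_ ?_
    · by_contra h
      push Not at h
      have hev := (hρ.contDiffAt (hV.mem_nhds hyV)).continuousAt.eventually (lt_mem_nhds h)
      have hcl : y ∈ closure Ω := frontier_subset_closure hy
      obtain ⟨z, ⟨hz0, hzV⟩, hzΩ⟩ :=
        mem_closure_iff_nhds.1 hcl _ (inter_mem hev (hV.mem_nhds hyV))
      have : z ∈ Ω ∩ V := ⟨hzΩ, hzV⟩
      rw [hΩV] at this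
      exact lt_asymm hz0 this.2
    · by_contra h
      have : y ∈ Ω ∩ V := hΩV ▸ ⟨hyV, not_le.1 h⟩
      exact hyΩ this.1
  have := hnormal _ ⟨V, ρ, hV, hyV, hρ, hΩV, hρy, hg, rfl⟩
  rw [inner_smul_right, mul_eq_zero, inv_eq_zero, norm_eq_zero] at this
  rw [← inner_gradient_left, real_inner_comm]
  exact this.resolve_left hg

/-- Interior points use `Ω` itself. At a boundary point the chart is shrunk until `ρ` grows
uniformly along `e = ∇ρ(x)`. Continuity of `F` on the compact set `K` makes its normal component
uniformly small near the boundary. -/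
theorem exists_nhd_setIntegral_divergence_smul_eq_zero (hΩ : IsOpen Ω)
    (hΩb : Bornology.IsBounded Ω) (hΓ : Γ ⊆ frontier Ω)
    (hΓn : ∀ x ∈ Γ, ∃ ν, IsOuterUnitNormal Ω x ν) (hK : IsCompact K) (hKΩ : K ⊆ Ω ∪ Γ)
    (hF : ContDiffOn ℝ 1 F Ω) (hFK : ContinuousOn F K)
    (hnormal : ∀ x ∈ Γ, ∀ ν, IsOuterUnitNormal Ω x ν → inner ℝ (F x) ν = 0)
    (hzero : ∀ x ∈ Ω, x ∉ K → F x = 0) {M : ℝ} (hdM : ∀ x ∈ Ω, |divergence F x| ≤ M)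
    {x : Space N} (hx : x ∈ K) :
    ∃ V, IsOpen V ∧ x ∈ V ∧ ∀ χ : Space N → ℝ, ContDiff ℝ 1 χ → HasCompactSupport χ →
      tsupport χ ⊆ V → (∀ y, 0 ≤ χ y) →
      ∫ y in Ω, (χ y * divergence F y + fderiv ℝ χ y (F y)) = 0 := by
  rcases hKΩ hx with hxΩ | hxΓ
  · exact ⟨Ω, hΩ, hxΩ, fun χ hχ hχc hχΩ _ =>
      setIntegral_divergence_smul_eq_zero_of_tsupport_subset hΩ hχ hχc hχΩ hF⟩
  obtain ⟨ν, W, ρ, hW, hxW, hρ, hΩW, -, hg, -⟩ := hΓn x hxΓ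
  set e := gradient ρ x with he
  have hpos : 0 < fderiv ℝ ρ x e := by
    rw [← inner_gradient_left, ← he, real_inner_self_eq_norm_sq]
    positivity
  have hcont : ContinuousOn (fun y => fderiv ℝ ρ y e) W :=
    (hρ.continuousOn_fderiv_of_isOpen hW (by simp)).clm_apply continuousOn_const
  set V := W ∩ (fun y => fderiv ℝ ρ y e) ⁻¹' Ioi (fderiv ℝ ρ x e / 2) with hVdef
  have hV : IsOpen V := hcont.isOpen_inter_preimage hW isOpen_Ioi
  have hρV : ContDiffOn ℝ 1 ρ V := hρ.mono inter_subset_left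
  have hΩV : Ω ∩ V = {y ∈ V | ρ y < 0} := by
    ext y
    have := Set.ext_iff.1 hΩW y
    simp only [mem_inter_iff, mem_ofPred_eq] at this
    simp only [hVdef, mem_inter_iff, mem_ofPred_eq]
    tauto
  refine ⟨V, hV, ⟨hxW, by simpa using hpos⟩, fun χ hχ hχc hχV hχ0 => ?_⟩
  obtain ⟨M', hM'⟩ := exists_forall_norm_le_of_eq_zero_off_compact hK hFK hzero
  refine setIntegral_divergence_smul_eq_zero_of_boundary_chart hΩ hV hρV hΩV (half_pos hpos)
    (fun y hy => (mem_Ioi.1 hy.2).le) hχ hχc hχV hχ0 hF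
    (integrableOn_divergence_smul hΩ hΩb hF hM' hdM hχ hχc) fun ε hε => ?_
  have hS : IsCompact (K ∩ tsupport χ) := hK.inter_right (isClosed_tsupport χ)
  have hfc : ContinuousOn (fun y => |fderiv ℝ ρ y (F y)|) (K ∩ tsupport χ) :=
    (((hρV.continuousOn_fderiv_of_isOpen hV (by simp)).mono
      fun y hy => hχV hy.2).clm_apply (hFK.mono inter_subset_left)).abs
  -- The points where the normal component is not small form a compact set which misses the
  -- boundary, so `ρ` is bounded away from `0` on it.
  set B := (K ∩ tsupport χ) ∩ (fun y => |fderiv ℝ ρ y (F y)|) ⁻¹' Ici ε with hB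
  have hBc : IsCompact B :=
    hS.of_isClosed_subset (hfc.preimage_isClosed_of_isClosed hS.isClosed isClosed_Ici)
      inter_subset_left
  have hBneg : ∀ y ∈ B, ρ y < 0 := by
    rintro y ⟨⟨hyK, hyχ⟩, hyε⟩
    have hyV := hχV hyχ
    by_cases hyΩ : y ∈ Ω
    · have : y ∈ Ω ∩ V := ⟨hyΩ, hyV⟩
      rw [hΩV] at this
      exact this.2
    · have hyΓ := (hKΩ hyK).resolve_left hyΩ
      have h0 := fderiv_apply_eq_zero_of_normal hV hρV hΩV (hΓ hyΓ) hyΩ hyV (hnormal y hyΓ)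
      have : ε ≤ |fderiv ℝ ρ y (F y)| := hyε
      rw [h0, abs_zero] at this
      exact absurd hε this.not_gt
  obtain ⟨δ, hδ, hBδ⟩ : ∃ δ > 0, ∀ y ∈ B, ρ y ≤ -δ := by
    rcases B.eq_empty_or_nonempty with hB0 | hBne
    · exact ⟨1, one_pos, by simp [hB0]⟩
    · obtain ⟨y₀, hy₀, hmax⟩ := hBc.exists_isMaxOn hBne
        (hρV.continuousOn.mono fun y hy => hχV hy.1.2)
      exact ⟨-ρ y₀, neg_pos.2 (hBneg y₀ hy₀), fun y hy => by simpa using hmax hy⟩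
  refine ⟨δ, hδ, fun y hy hρy hχy => ?_⟩
  by_contra hcon
  push Not at hcon
  have hyK : y ∈ K := by
    by_contra hyK
    rw [hzero y hy.1 hyK, map_zero, abs_zero] at hcon
    exact lt_asymm hε hcon
  exact absurd (hBδ y ⟨⟨hyK, subset_tsupport χ hχy⟩, hcon.le⟩) (not_le.2 hρy)

open scoped Manifold ContDiff in
/-- Divergence theorem for a field with compact support in `Ω ∪ Γ` whose normal component
vanishes on the part `Γ` of the boundary. -/
theorem setIntegral_divergence_eq_zero (hΩ : IsOpen Ω)
    (hΩb : Bornology.IsBounded Ω) (hΓ : Γ ⊆ frontier Ω)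
    (hΓn : ∀ x ∈ Γ, ∃ ν, IsOuterUnitNormal Ω x ν) (hK : IsCompact K) (hKΩ : K ⊆ Ω ∪ Γ)
    (hF : ContDiffOn ℝ 1 F Ω) (hFK : ContinuousOn F K)
    (hnormal : ∀ x ∈ Γ, ∀ ν, IsOuterUnitNormal Ω x ν → inner ℝ (F x) ν = 0)
    (hzero : ∀ x ∈ Ω, x ∉ interior K → F x = 0 ∧ divergence F x = 0)
    {M : ℝ} (hdM : ∀ x ∈ Ω, |divergence F x| ≤ M) :
    ∫ x in Ω, divergence F x = 0 := by
  have hzero' : ∀ x ∈ Ω, x ∉ K → F x = 0 := fun x hx hxK =>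
    (hzero x hx fun h => hxK (interior_subset h)).1
  have hloc := fun x : K => exists_nhd_setIntegral_divergence_smul_eq_zero hΩ hΩb hΓ hΓn hK hKΩ hF
    hFK hnormal hzero' hdM x.2
  choose V hV hxV hVint using hloc
  -- The unit balls serve only to give the functions of the partition compact support.
  obtain ⟨f, hf⟩ := SmoothPartitionOfUnity.exists_isSubordinate 𝓘(ℝ, Space N) hK.isClosed
    (fun x : K => V x ∩ Metric.ball (x : Space N) 1)
    (fun x => (hV x).inter Metric.isOpen_ball)
    (fun x hx => mem_iUnion.2 ⟨⟨x, hx⟩, hxV ⟨x, hx⟩, Metric.mem_ball_self one_pos⟩)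
  have hfC : ∀ i, ContDiff ℝ 1 (f i) := fun i =>
    ((f i).contMDiff.contDiff).of_le (by simp)
  have hfc : ∀ i, HasCompactSupport (f i) := fun i =>
    Metric.isCompact_of_isClosed_isBounded (isClosed_tsupport _)
      (Metric.isBounded_ball.subset ((hf i).trans inter_subset_right))
  have hfin := f.locallyFinite.finite_nonempty_inter_compact hK
  set s := hfin.toFinset with hs
  have hsum : ∀ x ∈ K, ∑ i ∈ s, f i x = 1 := by
    intro x hx
    rw [← f.sum_eq_one hx]
    refine (finsum_eq_sum_of_support_subset _ fun i hi => ?_).symm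
    simp only [hs, Set.Finite.coe_toFinset, mem_ofPred_eq]
    exact ⟨x, hi, hx⟩
  obtain ⟨M', hM'⟩ := exists_forall_norm_le_of_eq_zero_off_compact hK hFK hzero'
  have hEq : EqOn (divergence F)
      (fun x => ∑ i ∈ s, (f i x * divergence F x + fderiv ℝ (f i) x (F x))) Ω := by
    intro x hx
    -- The partition sums to `1` only on `K`, so the sum of its derivatives is known to vanish only
    -- in `interior K`. Elsewhere `F` and its divergence are both zero.
    by_cases hxK : x ∈ interior K
    · have h1 : (fun y => ∑ i ∈ s, f i y) =ᶠ[𝓝 x] fun _ => 1 := by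
        filter_upwards [mem_interior_iff_mem_nhds.1 hxK] with y hy using hsum y hy
      have h2 : ∑ i ∈ s, fderiv ℝ (f i) x = 0 := by
        rw [← fderiv_fun_sum fun i _ => (hfC i).differentiable (by simp) x, h1.fderiv_eq]
        simp
      simp only [Finset.sum_add_distrib, ← Finset.sum_mul, hsum x (interior_subset hxK), one_mul]
      rw [← sum_apply, h2]
      simp
    · simp [hzero x hx hxK]
  rw [setIntegral_congr_fun hΩ.measurableSet hEq, integral_finsetSum]
  · exact Finset.sum_eq_zero fun i _ => hVint i (f i) (hfC i) (hfc i)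
      ((hf i).trans inter_subset_left) (f.nonneg i)
  · exact fun i _ => integrableOn_divergence_smul hΩ hΩb hF hM' hdM (hfC i) (hfc i)

end Global

variable {Ω Γ₁ Γ₂ Γ₃ : Set (Space N)}

/-! ### Linear combinations and compositions of solutions -/

section Calculus

theorem gradient_comp {θ : ℝ → ℝ} {w : Space N → ℝ} {x : Space N}
    (hθ : DifferentiableAt ℝ θ (w x)) (hw : DifferentiableAt ℝ w x) :
    gradient (fun y => θ (w y)) x = deriv θ (w x) • gradient w x := by
  have h : HasFDerivAt (fun y => θ (w y)) (deriv θ (w x) • fderiv ℝ w x) x :=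
    hθ.hasDerivAt.comp_hasFDerivAt x hw.hasFDerivAt
  simp [gradient, h.fderiv]

theorem gradient_linear_combination {v w : Space N → ℝ} {x : Space N} (b c : ℝ)
    (hv : DifferentiableAt ℝ v x) (hw : DifferentiableAt ℝ w x) :
    gradient (fun y => b * v y + c * w y) x = b • gradient v x + c • gradient w x := by
  have h : HasFDerivAt (fun y => b * v y + c * w y) (b • fderiv ℝ v x + c • fderiv ℝ w x) x :=
    (hv.hasFDerivAt.const_mul b).add (hw.hasFDerivAt.const_mul c)
  simp [gradient, h.fderiv]

theorem SolvesDivEq.differentiableAt {A w : Space N → ℝ} (h : SolvesDivEq Ω A w)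
    (hΩ : IsOpen Ω) {x : Space N} (hx : x ∈ Ω) : DifferentiableAt ℝ w x :=
  (h.contDiffOn.contDiffAt (hΩ.mem_nhds hx)).differentiableAt (by simp)

theorem SolvesDivEq.linear_combination {A v w : Space N → ℝ} (hΩ : IsOpen Ω)
    (hv : SolvesDivEq Ω A v) (hw : SolvesDivEq Ω A w) (b c : ℝ) :
    SolvesDivEq Ω A (fun x => b * v x + c * w x) := by
  have hflux : EqOn (fun x => A x • gradient (fun x => b * v x + c * w x) x)
      (fun x => b • (A x • gradient v x) + c • (A x • gradient w x)) Ω := by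
    intro x hx
    simp only [gradient_linear_combination b c (hv.differentiableAt hΩ hx)
      (hw.differentiableAt hΩ hx), smul_add, smul_comm (A x)]
  refine ⟨(contDiffOn_const.mul hv.contDiffOn).add (contDiffOn_const.mul hw.contDiffOn), ?_, ?_⟩
  · exact ((hv.flux_contDiffOn.const_smul b).add (hw.flux_contDiffOn.const_smul c)).congr hflux
  · intro x hx
    have hvd := (hv.flux_contDiffOn.contDiffAt (hΩ.mem_nhds hx)).differentiableAt (by simp)
    have hwd := (hw.flux_contDiffOn.contDiffAt (hΩ.mem_nhds hx)).differentiableAt (by simp)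
    rw [divergence_congr (hflux.eventuallyEq_of_mem (hΩ.mem_nhds hx)),
      divergence_add (hvd.fun_const_smul b) (hwd.fun_const_smul c), divergence_const_smul b hvd,
      divergence_const_smul c hwd, hv.divergence_eq_zero x hx, hw.divergence_eq_zero x hx]
    simp

theorem MixedBoundaryConditions.linear_combination {v w : Space N → ℝ} {d d' : ℝ}
    (hv : MixedBoundaryConditions Ω Γ₁ Γ₂ Γ₃ d v) (hw : MixedBoundaryConditions Ω Γ₁ Γ₂ Γ₃ d' w)
    (hvd : ∀ x ∈ Ω, DifferentiableAt ℝ v x) (hwd : ∀ x ∈ Ω, DifferentiableAt ℝ w x) (b c : ℝ) :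
    MixedBoundaryConditions Ω Γ₁ Γ₂ Γ₃ (b * d + c * d') (fun x => b * v x + c * w x) := by
  refine ⟨(continuousOn_const.mul hv.continuousOn).add (continuousOn_const.mul hw.continuousOn),
    fun x hx => by simp [hv.eq_zero x hx, hw.eq_zero x hx], ?_,
    fun x hx => by simp [hv.eq_const x hx, hw.eq_const x hx]⟩
  obtain ⟨G, hG, hGv, hGn⟩ := hv.normalDeriv
  obtain ⟨H, hH, hHw, hHn⟩ := hw.normalDeriv
  refine ⟨fun x => b • G x + c • H x, (hG.const_smul b).add (hH.const_smul c), fun x hx => ?_,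
    fun x hx ν hν => ?_⟩
  · simp only [gradient_linear_combination b c (hvd x hx) (hwd x hx), hGv x hx, hHw x hx]
  · simp [inner_add_left, inner_smul_left, hGn x hx ν hν, hHn x hx ν hν]

theorem MixedBoundaryConditions.comp {w : Space N → ℝ} {c : ℝ}
    (hw : MixedBoundaryConditions Ω Γ₁ Γ₂ Γ₃ c w) (hΓ₂ : Γ₂ ⊆ closure Ω)
    (hwd : ∀ x ∈ Ω, DifferentiableAt ℝ w x) {θ : ℝ → ℝ} (hθ : ContDiff ℝ 1 θ) (hθ0 : θ 0 = 0) :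
    MixedBoundaryConditions Ω Γ₁ Γ₂ Γ₃ (θ c) (fun x => θ (w x)) := by
  refine ⟨hθ.continuous.comp_continuousOn hw.continuousOn,
    fun x hx => by simp [hw.eq_zero x hx, hθ0], ?_, fun x hx => by simp [hw.eq_const x hx]⟩
  obtain ⟨G, hG, hGw, hGn⟩ := hw.normalDeriv
  refine ⟨fun x => deriv θ (w x) • G x, ?_, fun x hx => ?_, fun x hx ν hν => ?_⟩
  · exact ((hθ.continuous_deriv le_rfl).comp_continuousOn
      (hw.continuousOn.mono (union_subset subset_closure hΓ₂))).smul hG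
  · simp only [gradient_comp (hθ.differentiable (by simp) _) (hwd x hx), hGw x hx]
  · simp [inner_smul_left, hGn x hx ν hν]

end Calculus

/-! ### Maximum principle by energy and uniqueness -/

section MaximumPrinciple

theorem deriv_smoothTransition_sub_nonneg (m s : ℝ) :
    0 ≤ deriv (fun t => Real.smoothTransition (t - m)) s :=
  Monotone.deriv_nonneg fun _ _ h => Real.smoothTransition.monotone (sub_le_sub_right h m)

theorem contDiff_smoothTransition_sub (m : ℝ) :
    ContDiff ℝ 1 (fun t => Real.smoothTransition (t - m)) :=
  Real.smoothTransition.contDiff.comp (contDiff_id.sub contDiff_const)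

/-- At such a point the function attains its global minimum `0`; this covers `s = m` as well. -/
theorem deriv_smoothTransition_sub_eq_zero {m s : ℝ} (h : s ≤ m) :
    deriv (fun t => Real.smoothTransition (t - m)) s = 0 := by
  refine IsLocalMin.deriv_eq_zero (Eventually.of_forall fun t => ?_)
  simp only [Real.smoothTransition.zero_of_nonpos (sub_nonpos.2 h)]
  exact Real.smoothTransition.nonneg _

/-- Energy identity: testing `∇·(A∇w) = 0` with a nondecreasing function of `w` that vanishes
below `m` shows that this function of `w` has vanishing gradient. -/
theorem SolvesDivEq.deriv_smul_gradient_eq_zero {A w : Space N → ℝ} {c m : ℝ}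
    (hΩ : IsOpen Ω) (hΩb : Bornology.IsBounded Ω) (hΓ : Γ₁ ∪ Γ₂ ∪ Γ₃ = frontier Ω)
    (hΓ₂ : ∀ x ∈ Γ₂, ∃ ν, IsOuterUnitNormal Ω x ν)
    (hA : ContinuousOn A (closure Ω)) (hApos : ∀ x ∈ Ω, 0 < A x)
    (h : SolvesDivEq Ω A w) (hw : MixedBoundaryConditions Ω Γ₁ Γ₂ Γ₃ c w)
    (hm : 0 < m) (hcm : c < m) {x : Space N} (hx : x ∈ Ω) :
    deriv (fun t => Real.smoothTransition (t - m)) (w x) • gradient w x = 0 := by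
  set φ : ℝ → ℝ := fun t => Real.smoothTransition (t - m) with hφ
  have hφC : ContDiff ℝ 1 φ := contDiff_smoothTransition_sub m
  have hφ' : Continuous (deriv φ) := hφC.continuous_deriv le_rfl
  have hΓ₂f : Γ₂ ⊆ frontier Ω := hΓ ▸ fun y hy => Or.inl (Or.inr hy)
  obtain ⟨G, hG, hGw, hGn⟩ := hw.normalDeriv
  -- Since `m` exceeds both Dirichlet data, this compact set can meet the boundary only in `Γ₂`.
  set K := closure Ω ∩ w ⁻¹' Ici m with hKdef
  have hK : IsCompact K := hΩb.isCompact_closure.of_isClosed_subset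
    (hw.continuousOn.preimage_isClosed_of_isClosed isClosed_closure isClosed_Ici)
    inter_subset_left
  have hKΩ : K ⊆ Ω ∪ Γ₂ := by
    rintro y ⟨hy, hym⟩
    by_cases hyΩ : y ∈ Ω
    · exact Or.inl hyΩ
    have hyf : y ∈ Γ₁ ∪ Γ₂ ∪ Γ₃ := by
      rw [hΓ, hΩ.frontier_eq]
      exact ⟨hy, hyΩ⟩
    have hym' : m ≤ w y := hym
    rcases hyf with (h1 | h2) | h3
    · rw [hw.eq_zero y h1] at hym'
      exact absurd hm hym'.not_gt
    · exact Or.inr h2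
    · rw [hw.eq_const y h3] at hym'
      exact absurd hcm hym'.not_gt
  -- `G` replaces `gradient w` so that the field is continuous up to `Γ₂`.
  set F : Space N → Space N := fun y => φ (w y) • (A y • G y) with hFdef
  have hFeq : EqOn F (fun y => φ (w y) • (A y • gradient w y)) Ω := fun y hy => by
    simp only [hFdef, hGw y hy]
  have hF : ContDiffOn ℝ 1 F Ω :=
    ((hφC.comp_contDiffOn h.contDiffOn).smul h.flux_contDiffOn).congr hFeq
  have hdiv : ∀ y ∈ Ω, divergence F y = deriv φ (w y) * (A y * ‖G y‖ ^ 2) := by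
    intro y hy
    have hwd := h.differentiableAt hΩ hy
    have hcomp : HasFDerivAt (fun z => φ (w z)) (deriv φ (w y) • fderiv ℝ w y) y :=
      (hφC.differentiable (by simp) _).hasDerivAt.comp_hasFDerivAt y hwd.hasFDerivAt
    rw [divergence_congr (hFeq.eventuallyEq_of_mem (hΩ.mem_nhds hy)),
      divergence_smul hcomp.differentiableAt
        ((h.flux_contDiffOn.contDiffAt (hΩ.mem_nhds hy)).differentiableAt (by simp)),
      h.divergence_eq_zero y hy, hcomp.fderiv, hGw y hy]
    simp only [mul_zero, zero_add, smul_apply, map_smul, smul_eq_mul]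
    rw [← inner_gradient_left, real_inner_self_eq_norm_sq]
    ring
  have hclosure : K ⊆ closure Ω := inter_subset_left
  have hFK : ContinuousOn F K :=
    (hφC.continuous.comp_continuousOn (hw.continuousOn.mono hclosure)).smul
      ((hA.mono hclosure).smul (hG.mono hKΩ))
  have hle : ∀ y ∈ Ω, y ∉ interior K → w y ≤ m := by
    intro y hy hyK
    by_contra hcon
    refine hyK (mem_interior_iff_mem_nhds.2 ?_)
    filter_upwards [hΩ.mem_nhds hy, (h.differentiableAt hΩ hy).continuousAt.eventually
      (lt_mem_nhds (not_le.1 hcon))] with z hz hzm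
    exact ⟨subset_closure hz, hzm.le⟩
  have hzero : ∀ y ∈ Ω, y ∉ interior K → F y = 0 ∧ divergence F y = 0 := by
    intro y hy hyK
    have hym := hle y hy hyK
    refine ⟨?_, ?_⟩
    · simp [hFdef, hφ, Real.smoothTransition.zero_of_nonpos (sub_nonpos.2 hym)]
    · rw [hdiv y hy, deriv_smoothTransition_sub_eq_zero hym, zero_mul]
  -- Since `∇·(A∇w) = 0`, the divergence of `F` involves only first derivatives of `w`, and these
  -- extend continuously to `K`. Hence it is bounded although no second derivatives are controlled.
  obtain ⟨M, hM⟩ := hK.exists_bound_of_continuousOn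
    (f := fun y => deriv φ (w y) * (A y * ‖G y‖ ^ 2))
    ((hφ'.comp_continuousOn (hw.continuousOn.mono hclosure)).mul
      ((hA.mono hclosure).mul ((hG.mono hKΩ).norm.pow 2)))
  have hdM : ∀ y ∈ Ω, |divergence F y| ≤ max M 0 := by
    intro y hy
    by_cases hyK : y ∈ K
    · rw [hdiv y hy]
      exact (hM y hyK).trans (le_max_left _ _)
    · rw [(hzero y hy fun h => hyK (interior_subset h)).2, abs_zero]
      exact le_max_right _ _
  have hint : ∫ y in Ω, divergence F y = 0 := by
    refine setIntegral_divergence_eq_zero hΩ hΩb hΓ₂f hΓ₂ hK hKΩ hF hFK (fun y hy ν hν => ?_)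
      hzero hdM
    simp [hFdef, inner_smul_left, hGn y hy ν hν]
  have hcont := continuousOn_divergence hΩ hF
  have hI : IntegrableOn (divergence F) Ω :=
    IntegrableOn.of_bound hΩb.measure_lt_top
      (hcont.aestronglyMeasurable hΩ.measurableSet) (max M 0)
      ((ae_restrict_mem hΩ.measurableSet).mono hdM)
  have hnn : ∀ y ∈ Ω, 0 ≤ divergence F y := fun y hy => by
    rw [hdiv y hy]
    exact mul_nonneg (deriv_smoothTransition_sub_nonneg m _)
      (mul_nonneg (hApos y hy).le (sq_nonneg _))
  have hae : divergence F =ᵐ[volume.restrict Ω] fun _ => 0 :=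
    (setIntegral_eq_zero_iff_of_nonneg_ae
      ((ae_restrict_mem hΩ.measurableSet).mono hnn) hI).1 hint
  -- The nonnegative divergence has zero integral, so it vanishes almost everywhere, and by
  -- continuity everywhere.
  have h0 : divergence F x = 0 :=
    Measure.eqOn_open_of_ae_eq hae hΩ hcont continuousOn_const hx
  rw [hdiv x hx, hGw x hx, mul_eq_zero, mul_eq_zero] at h0
  rcases h0 with h0 | h0 | h0
  · rw [h0, zero_smul]
  · exact absurd h0 (hApos x hx).ne'
  · rw [norm_eq_zero.1 (pow_eq_zero_iff two_ne_zero |>.1 h0), smul_zero]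

/-- Adding to a solution of the mixed problem a function with vanishing gradient and vanishing
Dirichlet data gives another solution. -/
theorem IsMixedHarmonic.add_of_gradient_eq_zero {z f : Space N → ℝ} (hΩ : IsOpen Ω)
    (hz : IsMixedHarmonic Ω Γ₁ Γ₂ Γ₃ z) (hfc : ContinuousOn f (closure Ω))
    (hfd : DifferentiableOn ℝ f Ω) (hf : ∀ x ∈ Ω, gradient f x = 0)
    (hf₁ : ∀ x ∈ Γ₁, f x = 0) (hf₃ : ∀ x ∈ Γ₃, f x = 0) :
    IsMixedHarmonic Ω Γ₁ Γ₂ Γ₃ (fun x => z x + f x) := by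
  -- `f` is constant on balls in `Ω`; connectedness of `Ω` is not needed.
  have hloc : ∀ x ∈ Ω, (fun y => z y + f y) =ᶠ[𝓝 x] fun y => z y + f x := by
    intro x hx
    obtain ⟨r, hr, hrΩ⟩ := Metric.isOpen_iff.1 hΩ x hx
    filter_upwards [Metric.ball_mem_nhds x hr] with y hy
    have := (convex_ball x r).is_const_of_fderivWithin_eq_zero (𝕜 := ℝ) (hfd.mono hrΩ)
      (fun y hy => by
        rw [fderivWithin_of_isOpen Metric.isOpen_ball hy, ← toDual_gradient, hf y (hrΩ hy),
          map_zero]) hy (Metric.mem_ball_self hr)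
    rw [this]
  have hzd : ∀ x ∈ Ω, ContDiffAt ℝ 2 z x := fun x hx => hz.contDiffOn.contDiffAt (hΩ.mem_nhds hx)
  refine ⟨fun x hx => ?_, fun x hx => ?_, ⟨hz.boundary.continuousOn.add hfc, ?_, ?_, ?_⟩⟩
  · exact (((hzd x hx).add contDiffAt_const).congr_of_eventuallyEq (hloc x hx)).contDiffWithinAt
  · have hsum : Laplacian.laplacian (fun y => z y + f x) x = Laplacian.laplacian z x := by
      have := (hzd x hx).laplacian_add (contDiffAt_const (c := f x))
      simp only [laplacian_const, Pi.zero_apply, add_zero] at this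
      exact this
    rw [(laplacian_congr_nhds (hloc x hx)).eq_of_nhds, hsum, hz.laplacian_eq_zero x hx]
  · exact fun x hx => by simp [hz.boundary.eq_zero x hx, hf₁ x hx]
  · obtain ⟨G, hG, hGz, hGn⟩ := hz.boundary.normalDeriv
    refine ⟨G, hG, fun x hx => ?_, hGn⟩
    rw [hGz x hx, (hloc x hx).gradient_eq]
    simp [gradient]
  · exact fun x hx => by simp [hz.boundary.eq_const x hx, hf₃ x hx]

/-- For each `m > max 0 c`, adding `Real.smoothTransition (w - m)` to `z` gives another solution of
the mixed Laplace problem. By uniqueness the added term is zero, that is, `w ≤ m`. -/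
theorem SolvesDivEq.le_max {A w : Space N → ℝ} {c : ℝ}
    (hΩ : IsOpen Ω) (hΩb : Bornology.IsBounded Ω) (hΓ : Γ₁ ∪ Γ₂ ∪ Γ₃ = frontier Ω)
    (hΓ₂ : ∀ x ∈ Γ₂, ∃ ν, IsOuterUnitNormal Ω x ν)
    (hΔ : MixedLaplaceUniquelySolvable Ω Γ₁ Γ₂ Γ₃)
    (hA : ContinuousOn A (closure Ω)) (hApos : ∀ x ∈ Ω, 0 < A x)
    (h : SolvesDivEq Ω A w) (hw : MixedBoundaryConditions Ω Γ₁ Γ₂ Γ₃ c w)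
    {x : Space N} (hx : x ∈ closure Ω) : w x ≤ max 0 c := by
  refine le_of_forall_gt_imp_ge_of_dense fun m hm => ?_
  obtain ⟨hm0, hcm⟩ := max_lt_iff.1 hm
  obtain ⟨⟨z, hz⟩, huniq⟩ := hΔ
  have hφC := contDiff_smoothTransition_sub m
  have hz' : IsMixedHarmonic Ω Γ₁ Γ₂ Γ₃ (fun y => z y + Real.smoothTransition (w y - m)) := by
    refine hz.add_of_gradient_eq_zero hΩ (hφC.continuous.comp_continuousOn hw.continuousOn)
      ((hφC.differentiable (by simp)).comp_differentiableOn
        (h.contDiffOn.differentiableOn (by simp))) (fun y hy => ?_) (fun y hy => ?_)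
      (fun y hy => ?_)
    · rw [← h.deriv_smul_gradient_eq_zero hΩ hΩb hΓ hΓ₂ hA hApos hw hm0 hcm hy]
      exact gradient_comp (hφC.differentiable (by simp) _) (h.differentiableAt hΩ hy)
    · rw [hw.eq_zero y hy]
      exact Real.smoothTransition.zero_of_nonpos (by linarith)
    · rw [hw.eq_const y hy]
      exact Real.smoothTransition.zero_of_nonpos (by linarith)
  have := huniq _ _ hz' hz hx
  simp only [add_eq_left, Real.smoothTransition.zero_iff_nonpos] at this
  linarith

theorem SolvesDivEq.mem_uIcc {A w : Space N → ℝ} {c : ℝ}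
    (hΩ : IsOpen Ω) (hΩb : Bornology.IsBounded Ω) (hΓ : Γ₁ ∪ Γ₂ ∪ Γ₃ = frontier Ω)
    (hΓ₂ : ∀ x ∈ Γ₂, ∃ ν, IsOuterUnitNormal Ω x ν)
    (hΔ : MixedLaplaceUniquelySolvable Ω Γ₁ Γ₂ Γ₃)
    (hA : ContinuousOn A (closure Ω)) (hApos : ∀ x ∈ Ω, 0 < A x)
    (h : SolvesDivEq Ω A w) (hw : MixedBoundaryConditions Ω Γ₁ Γ₂ Γ₃ c w)
    {x : Space N} (hx : x ∈ closure Ω) : w x ∈ uIcc 0 c := by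
  have hd : ∀ y ∈ Ω, DifferentiableAt ℝ w y := fun y hy => h.differentiableAt hΩ hy
  have h1 := h.le_max hΩ hΩb hΓ hΓ₂ hΔ hA hApos hw hx
  -- The lower bound is the upper bound for `-w`, written as the combination `-1 * w + 0 * w`.
  have h2 := (h.linear_combination hΩ h (-1) 0).le_max hΩ hΩb hΓ hΓ₂ hΔ hA hApos
    (hw.linear_combination hw hd hd (-1) 0) hx
  simp only [neg_mul, one_mul, zero_mul, add_zero] at h2
  refine ⟨?_, h1⟩
  change min 0 c ≤ w x
  rcases le_total 0 c with hc | hc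
  · rw [max_eq_left (by linarith)] at h2
    rw [min_eq_left hc]
    linarith
  · rw [max_eq_right (by linarith)] at h2
    rw [min_eq_right hc]
    linarith

end MaximumPrinciple

/-! ### Kirchhoff transform -/

section Kirchhoff

/-- The Kirchhoff transform: a `C¹` diffeomorphism of `ℝ` fixing `0` with prescribed derivative
bounded below by a positive constant. -/
theorem exists_contDiff_diffeomorph_of_deriv {b : ℝ → ℝ} (hb : Continuous b) {α : ℝ} (hα : 0 < α)
    (hbα : ∀ s, α ≤ b s) :
    ∃ Φ Ψ : ℝ → ℝ, ContDiff ℝ 1 Φ ∧ ContDiff ℝ 1 Ψ ∧ Φ 0 = 0 ∧ Ψ 0 = 0 ∧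
      Function.LeftInverse Ψ Φ ∧ Function.RightInverse Ψ Φ ∧ deriv Φ = b := by
  set Φ : ℝ → ℝ := fun s => ∫ t in (0 : ℝ)..s, b t with hΦ
  have hd : ∀ s, HasDerivAt Φ (b s) s := fun s => hb.integral_hasStrictDerivAt 0 s |>.hasDerivAt
  have hderiv : deriv Φ = b := funext fun s => (hd s).deriv
  have hΦC : ContDiff ℝ 1 Φ :=
    contDiff_one_iff_deriv.2 ⟨fun s => (hd s).differentiableAt, hderiv ▸ hb⟩
  have hΦ0 : Φ 0 = 0 := by simp [hΦ]
  have hpos : ∀ s, 0 < b s := fun s => hα.trans_le (hbα s)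
  have hmono : StrictMono Φ := strictMono_of_deriv_pos fun s => by rw [hderiv]; exact hpos s
  -- The lower bound on `b` makes `Φ` grow at least linearly at both ends, hence surjective.
  have hsub : Monotone fun s => Φ s - α * s := by
    have hd' : ∀ s, HasDerivAt (fun s => Φ s - α * s) (b s - α * 1) s := fun s =>
      (hd s).sub ((hasDerivAt_id s).const_mul α)
    refine monotone_of_deriv_nonneg (fun s => (hd' s).differentiableAt) fun s => ?_
    rw [(hd' s).deriv]
    linarith [hbα s]
  have hsurj : Function.Surjective Φ := by
    refine hΦC.continuous.surjective ?_ ?_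
    · refine tendsto_atTop_mono' _ ?_ (tendsto_id.const_mul_atTop hα)
      filter_upwards [eventually_ge_atTop 0] with s hs
      have := hsub hs
      simp only [hΦ0] at this
      simp only [id]
      linarith
    · refine tendsto_atBot_mono' _ ?_ (tendsto_id.const_mul_atBot hα)
      filter_upwards [eventually_le_atBot 0] with s hs
      have := hsub hs
      simp only [hΦ0] at this
      simp only [id]
      linarith
  set E := hmono.orderIsoOfSurjective Φ hsurj with hE
  have hleft : Function.LeftInverse E.symm Φ := fun s => E.symm_apply_apply s
  have hright : Function.RightInverse E.symm Φ := fun s => E.apply_symm_apply s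
  have hcont : Continuous E.symm := E.symm.continuous
  have hd' : ∀ y, HasDerivAt E.symm (b (E.symm y))⁻¹ y := fun y =>
    (hd (E.symm y)).of_local_left_inverse hcont.continuousAt (hpos _).ne'
      (Eventually.of_forall hright)
  refine ⟨Φ, E.symm, hΦC, ?_, hΦ0, ?_, hleft, hright, hderiv⟩
  · refine contDiff_one_iff_deriv.2 ⟨fun y => (hd' y).differentiableAt, ?_⟩
    rw [show deriv E.symm = fun y => (b (E.symm y))⁻¹ from funext fun y => (hd' y).deriv]
    exact (hb.comp hcont).inv₀ fun y => (hpos _).ne'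
  · simpa [hΦ0] using hleft 0

theorem SolvesDivEq.congr_coefficient {A A' w : Space N → ℝ} (hΩ : IsOpen Ω)
    (h : SolvesDivEq Ω A w) (hA : EqOn A' A Ω) : SolvesDivEq Ω A' w := by
  have hflux : EqOn (fun x => A' x • gradient w x) (fun x => A x • gradient w x) Ω :=
    fun x hx => by simp only [hA hx]
  refine ⟨h.contDiffOn, h.flux_contDiffOn.congr hflux, fun x hx => ?_⟩
  rw [divergence_congr (hflux.eventuallyEq_of_mem (hΩ.mem_nhds hx))]
  exact h.divergence_eq_zero x hx

/-- The gradient of `Φ(q)` is exactly the flux `b(q)∇q`, which is `C¹` and divergence free. Dividing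
by `Φ c` normalizes the datum to `1`. -/
theorem SolvesDivEq.isMixedHarmonic_kirchhoff {b Φ : ℝ → ℝ} {q : Space N → ℝ} {c : ℝ}
    (hΩ : IsOpen Ω) (hΓ₂ : Γ₂ ⊆ closure Ω) (hΦ : ContDiff ℝ 1 Φ) (hΦ0 : Φ 0 = 0)
    (hΦb : deriv Φ = b) (hc : Φ c ≠ 0) (h : SolvesDivEq Ω (fun x => b (q x)) q)
    (hq : MixedBoundaryConditions Ω Γ₁ Γ₂ Γ₃ c q) :
    IsMixedHarmonic Ω Γ₁ Γ₂ Γ₃ (fun x => (Φ c)⁻¹ * Φ (q x)) := by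
  have hθ : ContDiff ℝ 1 (fun s => (Φ c)⁻¹ * Φ s) := contDiff_const.mul hΦ
  have hd := fun x (hx : x ∈ Ω) => h.differentiableAt hΩ hx
  have hgrad : EqOn (gradient fun x => (Φ c)⁻¹ * Φ (q x))
      (fun x => (Φ c)⁻¹ • (b (q x) • gradient q x)) Ω := by
    intro x hx
    rw [gradient_comp (θ := fun s => (Φ c)⁻¹ * Φ s) (hθ.differentiable (by simp) _) (hd x hx),
      deriv_const_mul _ (hΦ.differentiable (by simp) _), hΦb, mul_smul]
  have hC2 : ContDiffOn ℝ 2 (fun x => (Φ c)⁻¹ * Φ (q x)) Ω :=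
    contDiffOn_of_gradient hΩ
      ((hθ.differentiable (by simp)).comp_differentiableOn
        (h.contDiffOn.differentiableOn (by simp)))
      ((h.flux_contDiffOn.const_smul _).congr hgrad)
  refine ⟨hC2, fun x hx => ?_, ?_⟩
  · rw [← divergence_gradient (hC2.contDiffAt (hΩ.mem_nhds hx)),
      divergence_congr (hgrad.eventuallyEq_of_mem (hΩ.mem_nhds hx)),
      divergence_const_smul _
        ((h.flux_contDiffOn.contDiffAt (hΩ.mem_nhds hx)).differentiableAt (by simp)),
      h.divergence_eq_zero x hx, mul_zero]
  · have := hq.comp hΓ₂ hd hθ (by simp [hΦ0])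
    simpa only [inv_mul_cancel₀ hc] using this

/-- With `q = Ψ(P z)` one has `Φ(q) = P z`, so the flux `b(q)∇q` equals `P∇z`. -/
theorem IsMixedHarmonic.solvesDivEq_kirchhoff {b Φ Ψ : ℝ → ℝ} {z : Space N → ℝ}
    (hΩ : IsOpen Ω) (hΦ : ContDiff ℝ 1 Φ) (hΨ : ContDiff ℝ 1 Ψ)
    (hΦΨ : Function.RightInverse Ψ Φ) (hΦb : deriv Φ = b)
    (hz : IsMixedHarmonic Ω Γ₁ Γ₂ Γ₃ z) (P : ℝ) :
    SolvesDivEq Ω (fun x => b (Ψ (P * z x))) (fun x => Ψ (P * z x)) := by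
  have hzd : ∀ x ∈ Ω, DifferentiableAt ℝ z x := fun x hx =>
    (hz.contDiffOn.contDiffAt (hΩ.mem_nhds hx)).differentiableAt (by simp)
  have hqC : ContDiffOn ℝ 1 (fun x => Ψ (P * z x)) Ω :=
    hΨ.comp_contDiffOn (contDiffOn_const.mul (hz.contDiffOn.of_le (by norm_num)))
  have hflux : EqOn (fun x => b (Ψ (P * z x)) • gradient (fun x => Ψ (P * z x)) x)
      (fun x => P • gradient z x) Ω := by
    intro x hx
    have hqd : DifferentiableAt ℝ (fun x => Ψ (P * z x)) x :=
      (hqC.contDiffAt (hΩ.mem_nhds hx)).differentiableAt (by simp)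
    have h1 := gradient_comp (θ := Φ) (hΦ.differentiable (by simp) (Ψ (P * z x))) hqd
    simp only [hΦΨ (P * z _), hΦb] at h1
    have h2 := gradient_linear_combination P 0 (hzd x hx) (hzd x hx)
    simp only [zero_mul, add_zero, zero_smul] at h2
    exact h1.symm.trans h2
  have hgC : ContDiffOn ℝ 1 (gradient z) Ω :=
    contDiffOn_gradient hΩ hz.contDiffOn (by norm_num [one_add_one_eq_two])
  refine ⟨hqC, (hgC.const_smul P).congr hflux, fun x hx => ?_⟩
  rw [divergence_congr (hflux.eventuallyEq_of_mem (hΩ.mem_nhds hx)),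
    divergence_const_smul P ((hgC.contDiffAt (hΩ.mem_nhds hx)).differentiableAt (by simp)),
    divergence_gradient (hz.contDiffOn.contDiffAt (hΩ.mem_nhds hx)),
    hz.laplacian_eq_zero x hx, mul_zero]

end Kirchhoff

/-! ### The system: proportionality of the components -/

section System

variable {a : ℝ → ℝ → ℝ} {α uStar pStar : ℝ}

theorem continuousOn_coefficient (ha : Continuous (Function.uncurry a)) {v q : Space N → ℝ}
    {s : Set (Space N)} (hv : ContinuousOn v s) (hq : ContinuousOn q s) :
    ContinuousOn (fun x => a (v x) (q x)) s :=
  ha.comp_continuousOn (hv.prodMk hq)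

/-- In a classical solution the two components are proportional, and the second one takes its
values between its boundary values. -/
theorem eq_mul_and_mem_uIcc_of_mem_classicalSolutions (hΩ : IsOpen Ω)
    (hΩb : Bornology.IsBounded Ω) (hΓ : Γ₁ ∪ Γ₂ ∪ Γ₃ = frontier Ω)
    (hΓ₂ : ∀ x ∈ Γ₂, ∃ ν, IsOuterUnitNormal Ω x ν)
    (hΔ : MixedLaplaceUniquelySolvable Ω Γ₁ Γ₂ Γ₃) (ha : Continuous (Function.uncurry a))
    (hα : 0 < α) (haα : ∀ u p, α ≤ a u p) (hpStar : pStar ≠ 0) {v q : Space N → ℝ}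
    (h : (v, q) ∈ classicalSolutions Ω Γ₁ Γ₂ Γ₃ a uStar pStar) {x : Space N}
    (hx : x ∈ closure Ω) : v x = uStar / pStar * q x ∧ q x ∈ uIcc 0 pStar := by
  obtain ⟨hv, hq, hvb, hqb⟩ := h
  have hA := continuousOn_coefficient ha hvb.continuousOn hqb.continuousOn
  have hApos : ∀ x ∈ Ω, 0 < a (v x) (q x) := fun x _ => hα.trans_le (haα _ _)
  refine ⟨?_, hq.mem_uIcc hΩ hΩb hΓ hΓ₂ hΔ hA hApos hqb hx⟩
  -- `v - (u*/p*) q` has datum `0` on `Γ₃` too, so the interval of the maximum principle shrinks to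
  -- a point.
  have hw := (hv.linear_combination hΩ hq 1 (-(uStar / pStar))).mem_uIcc hΩ hΩb hΓ hΓ₂ hΔ hA hApos
    (hvb.linear_combination hqb (fun y hy => hv.differentiableAt hΩ hy)
      (fun y hy => hq.differentiableAt hΩ hy) 1 (-(uStar / pStar))) hx
  rw [show 1 * uStar + -(uStar / pStar) * pStar = 0 by field_simp; ring, uIcc_self,
    mem_singleton_iff] at hw
  linarith

theorem classicalSolutions_subset_functionalSolutions (hΩ : IsOpen Ω)
    (hΩb : Bornology.IsBounded Ω) (hΓ : Γ₁ ∪ Γ₂ ∪ Γ₃ = frontier Ω)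
    (hΓ₂ : ∀ x ∈ Γ₂, ∃ ν, IsOuterUnitNormal Ω x ν)
    (hΔ : MixedLaplaceUniquelySolvable Ω Γ₁ Γ₂ Γ₃) (ha : Continuous (Function.uncurry a))
    (hα : 0 < α) (haα : ∀ u p, α ≤ a u p) (hpStar : pStar ≠ 0) :
    classicalSolutions Ω Γ₁ Γ₂ Γ₃ a uStar pStar ⊆
      functionalSolutions Ω Γ₁ Γ₂ Γ₃ a uStar pStar := by
  rintro ⟨v, q⟩ h
  refine ⟨h, fun s => uStar / pStar * s, contDiffOn_const.mul contDiffOn_id, fun x hx => ?_⟩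
  exact (eq_mul_and_mem_uIcc_of_mem_classicalSolutions hΩ hΩb hΓ hΓ₂ hΔ ha hα haα hpStar h
    hx).symm

end System

end MixedProblem

open MixedProblem

theorem theorem4p4 {N : ℕ} (Ω Γ₁ Γ₂ Γ₃ : Set (MixedProblem.Space N))
    (hΩ_open : IsOpen Ω) (hΩ_bdd : Bornology.IsBounded Ω)
    (hΓ : Γ₁ ∪ Γ₂ ∪ Γ₃ = frontier Ω)
    (h₁₂ : Disjoint Γ₁ Γ₂) (h₁₃ : Disjoint Γ₁ Γ₃) (h₂₃ : Disjoint Γ₂ Γ₃)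
    (hΓ₂ : ∀ x ∈ Γ₂, ∃ ν, MixedProblem.IsOuterUnitNormal Ω x ν)
    (hΔ : MixedProblem.MixedLaplaceUniquelySolvable Ω Γ₁ Γ₂ Γ₃)
    (a : ℝ → ℝ → ℝ) (ha : Continuous (Function.uncurry a))
    (α : ℝ) (hα : 0 < α) (haα : ∀ u p, α ≤ a u p)
    (uStar pStar : ℝ) (hpStar : pStar ≠ 0) :
    (∃ u p, (u, p) ∈ MixedProblem.classicalSolutions Ω Γ₁ Γ₂ Γ₃ a uStar pStar ∧
      (u, p) ∈ MixedProblem.functionalSolutions Ω Γ₁ Γ₂ Γ₃ a uStar pStar ∧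
      (∀ x ∈ closure Ω, u x = uStar / pStar * p x) ∧
      ∀ v q, (v, q) ∈ MixedProblem.classicalSolutions Ω Γ₁ Γ₂ Γ₃ a uStar pStar →
        Set.EqOn v u (closure Ω) ∧ Set.EqOn q p (closure Ω)) ∧
    MixedProblem.functionalSolutions Ω Γ₁ Γ₂ Γ₃ a uStar pStar =
      MixedProblem.classicalSolutions Ω Γ₁ Γ₂ Γ₃ a uStar pStar := by
  have hsub := classicalSolutions_subset_functionalSolutions (uStar := uStar) hΩ_open hΩ_bdd hΓ
    hΓ₂ hΔ ha hα haα hpStar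
  refine ⟨?_, Subset.antisymm (fun s hs => hs.1) hsub⟩
  have hΓ₂c : Γ₂ ⊆ closure Ω := fun y hy =>
    frontier_subset_closure (hΓ ▸ Or.inl (Or.inr hy) : y ∈ frontier Ω)
  set l := uStar / pStar with hl
  -- The coefficient along the line `u = l * p`, on which all solutions must lie.
  set b : ℝ → ℝ := fun s => a (l * s) s with hb
  have hbc : Continuous b := ha.comp ((continuous_const.mul continuous_id).prodMk continuous_id)
  obtain ⟨Φ, Ψ, hΦ, hΨ, hΦ0, hΨ0, hΨΦ, hΦΨ, hΦb⟩ :=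
    exists_contDiff_diffeomorph_of_deriv hbc hα fun s => haα _ _
  have hP : Φ pStar ≠ 0 := fun h => hpStar (hΨΦ.injective (h.trans hΦ0.symm))
  obtain ⟨z, hz⟩ := hΔ.1
  have hzd : ∀ x ∈ Ω, DifferentiableAt ℝ z x := fun x hx =>
    (hz.contDiffOn.contDiffAt (hΩ_open.mem_nhds hx)).differentiableAt (by simp)
  set p : Space N → ℝ := fun x => Ψ (Φ pStar * z x) with hp
  have hpsol : SolvesDivEq Ω (fun x => b (p x)) p :=
    hz.solvesDivEq_kirchhoff hΩ_open hΦ hΨ hΦΨ hΦb (Φ pStar)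
  have hpd : ∀ x ∈ Ω, DifferentiableAt ℝ p x := fun x hx => hpsol.differentiableAt hΩ_open hx
  have hpbc : MixedBoundaryConditions Ω Γ₁ Γ₂ Γ₃ pStar p := by
    have := hz.boundary.comp hΓ₂c hzd (θ := fun s => Ψ (Φ pStar * s))
      (hΨ.comp (contDiff_const.mul contDiff_id)) (by simp [hΨ0])
    simpa only [mul_one, hΨΦ pStar] using this
  have husol := hpsol.linear_combination hΩ_open hpsol l 0
  have hubc := hpbc.linear_combination hpbc hpd hpd l 0
  simp only [zero_mul, add_zero] at husol hubc
  rw [hl, div_mul_cancel₀ uStar hpStar, ← hl] at hubc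
  have hmem : ((fun x => l * p x, p) : (Space N → ℝ) × (Space N → ℝ)) ∈
      classicalSolutions Ω Γ₁ Γ₂ Γ₃ a uStar pStar := ⟨husol, hpsol, hubc, hpbc⟩
  refine ⟨fun x => l * p x, p, hmem, hsub hmem, fun x _ => rfl, fun v q hvq => ?_⟩
  have hvl : ∀ x ∈ closure Ω, v x = l * q x := fun x hx =>
    (eq_mul_and_mem_uIcc_of_mem_classicalSolutions hΩ_open hΩ_bdd hΓ hΓ₂ hΔ ha hα haα hpStar hvq
      hx).1
  -- By proportionality any solution satisfies the scalar equation, and its Kirchhoff transform is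
  -- then identified with `z`.
  have hqsol : SolvesDivEq Ω (fun x => b (q x)) q :=
    hvq.2.1.congr_coefficient hΩ_open fun x hx => by
      simp only [hb, hvl x (subset_closure hx)]
  have hqz := hΔ.2 _ _ (hqsol.isMixedHarmonic_kirchhoff hΩ_open hΓ₂c hΦ hΦ0 hΦb hP hvq.2.2.2) hz
  have hqp : EqOn q p (closure Ω) := fun x hx => by
    simp only [hp, ← hqz hx, mul_inv_cancel_left₀ hP, hΨΦ (q x)]
  exact ⟨fun x hx => by rw [hvl x hx, hqp hx], hqp⟩
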